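/- Let $(X,d)$ be a compact metric space, let $\mu$ be a finite positive Borel measure on $X$, let $m,N\ge 1$ be integers and let $1<p<\infty$. Let $\mathcal A(X)$ be a subalgebra of $C(X)$ that contains the constants and has the Urysohn property: whenever $K\subset V\subset X$ with $K$ compact and $V$ open, there is $\varphi\in\mathcal A(X)$ with values in $[0,1]$, equal to $0$ on $X\setminus V$ and to $1$ on $K$. Let $\mathcal K(X)$ be the class of the sets $\{x:\mathrm{dist}(x,B)\le\varepsilon\}$ and $\{x:\mathrm{dist}(x,B)\ge\varepsilon\}$ with $B\subset X$ open and $\varepsilon>0$ (where $\mathrm{dist}(x,\emptyset)=\infty$), and of the closed balls $\{y:d(x,y)\le\rho\}$ with $x\in X$, $\rho>0$ and $\mu(\{y:d(x,y)=\rho\})=0$. Let $D:\mathcal A(X)\to L^\infty_\mu(X;\mathbb R^N)$ be a linear operator such that $D(fg)=f\,Dg+g\,Df$ for all $f,g\in\mathcal A(X)$ and such that, if $f\in\mathcal A(X)$ is constant on a set $K\in\mathcal K(X)$, then $Df=0$ $\mu$-a.e. on $K$. Put $\mathcal A(X;\mathbb R^m):=\mathcal A(X)^m$ and let $\nabla u\in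 L^\infty_\mu(X;\mathbb M^{m\times N})$ be the field with rows $Du_1,\dots,Du_m$, for $u=(u_1,\dots,u_m)\in\mathcal A(X;\mathbb R^m)$, where $\mathbb M^{m\times N}$ is the space of real $m\times N$ matrices with its Euclidean inner product. Let $\mathcal H_0^m$ be the set of all $\nabla v\in L^\infty_\mu(X;\mathbb M^{m\times N})$ with $v\in\mathcal A(X;\mathbb R^m)$ and $v=0$ on $\operatorname{supp}\mu$. The normal space $N_\mu^m(x)=\{w(x):w\in\mathcal H_0^m\}$ is understood as the $\mu$-essential supremum of $\mathcal H_0^m$, that is, as the family of linear subspaces of $\mathbb M^{m\times N}$, unique up to equality for $\mu$-a.e. $x$, such that each $w\in\mathcal H^m_0$ satisfies $w(x)\in N_\mu^m(x)$ for $\mu$-a.e. $x$, and such that $N_\mu^m(x)\subset\Gamma(x)$ for $\mu$-a.e. $x$ whenever $\Gamma$ is a family of closed sets $\Gamma(x)\subset\mathbb M^{m\times N}$ with the property that each $w\in\mathcal H_0^m$ satisfies $w(x)\in\Gamma(x)$ for $\mu$-a.e. $x$. Let $T_\mu^m(x)$ be the orthogonal complement of $N_\mu^m(x)$, let $P_\mu^m(x)$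 be the orthogonal projection onto $T_\mu^m(x)$, and set $\nabla_\mu u(x):=P_\mu^m(x)(\nabla u(x))$. Let $W^{1,p}_\mu(X;\mathbb R^m)$ be the completion of $\mathcal A(X;\mathbb R^m)$ for $\|u\|_{L^p_\mu}+\|\nabla_\mu u\|_{L^p_\mu}$; the identity on $\mathcal A(X;\mathbb R^m)$ induces a map $W^{1,p}_\mu(X;\mathbb R^m)\to L^p_\mu(X;\mathbb R^m)$, and convergence in $L^p_\mu$ to an element of $W^{1,p}_\mu(X;\mathbb R^m)$ means convergence to its image under this map. For $\mu$-a.e. $x\in X$ let $L_x:\mathbb M^{m\times N}\to[0,\infty]$ be continuous, let $x\mapsto L_x(\xi)$ be $\mu$-measurable for every $\xi$, and suppose that there is $c>0$ with $$L_x(\xi)\le c(1+|\xi|^p)\quad\text{for all }\xi\in\mathbb M^{m\times N}\text{ and }\mu\text{-a.e. }x\in X.$$ Put $\widehat L_x(\xi):=\inf_{\zeta\in N_\mu^m(x)}L_x(\xi+\zeta)$ for $\xi\in T_\mu^m(x)$ and, for $u\in\mathcal A(X;\mathbb R^m)$ and $A\subset X$ open, $$E(u;A):=\int_A L_x(\nabla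 u(x))\,d\mu(x),\qquad \widehat E(u;A):=\int_A\widehat L_x(\nabla_\mu u(x))\,d\mu(x).$$ **Proposition.** For all $u\in W^{1,p}_\mu(X;\mathbb R^m)$ and all open $A\subset X$, $$\inf\Big\{\liminf_{n\to\infty}E(u_n;A):\mathcal A(X;\mathbb R^m)\ni u_n\to u\text{ in }L^p_\mu(X;\mathbb R^m)\Big\}=\inf\Big\{\liminf_{n\to\infty}\widehat E(u_n;A):\mathcal A(X;\mathbb R^m)\ni u_n\to u\text{ in }L^p_\mu(X;\mathbb R^m)\Big\}.$$ -/

import Mathlib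

open MeasureTheory Filter Topology
open scoped ENNReal

namespace MetricRelax

/-- `ℝᵏ` with its Euclidean norm. -/
abbrev Vec (k : ℕ) : Type := EuclideanSpace ℝ (Fin k)

/-- Real `m × N` matrices, stored as the `m`-tuple of their rows in `ℝᴺ`, with the Euclidean
(Frobenius) inner product and norm. -/
abbrev Mat (m N : ℕ) : Type := PiLp 2 (fun _ : Fin m => Vec N)

section Space

variable {X : Type*} [MetricSpace X]

/-- For every compact `K` contained in an open `V`, the algebra contains a function with values in
`[0, 1]` that vanishes outside `V` and equals `1` on `K`. -/
def UrysohnProperty (𝒜 : Subalgebra ℝ C(X, ℝ)) : Prop :=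
  ∀ K V : Set X, IsCompact K → IsOpen V → K ⊆ V →
    ∃ φ ∈ 𝒜, (∀ x, φ x ∈ Set.Icc (0 : ℝ) 1) ∧ (∀ x ∉ V, φ x = 0) ∧ ∀ x ∈ K, φ x = 1

variable [MeasurableSpace X]

/-- The class `𝒦(X)`: the sets `{dist(·, A) ≤ ε}` and `{dist(·, A) ≥ ε}` with `A` open and `ε > 0`,
and the closed balls of positive radius whose bounding sphere is `μ`-null. -/
def localitySets (μ : Measure X) : Set (Set X) :=
  {K | (∃ (A : Set X) (ε : ℝ), IsOpen A ∧ 0 < ε ∧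
        (K = {x | Metric.infEDist x A ≤ ENNReal.ofReal ε} ∨
          K = {x | ENNReal.ofReal ε ≤ Metric.infEDist x A})) ∨
      ∃ (x : X) (ρ : ℝ), 0 < ρ ∧ μ {y | dist x y = ρ} = 0 ∧ K = Metric.closedBall x ρ}

/-- The two properties required of the linear operator `D : 𝒜(X) → L^∞_μ(X; ℝᴺ)`: the Leibniz rule,
and the vanishing of `D f` almost everywhere on every set of `𝒦(X)` on which `f` is constant. -/
structure IsGradientOperator (μ : Measure X) {𝒜 : Subalgebra ℝ C(X, ℝ)} {N : ℕ}
    (D : 𝒜 →ₗ[ℝ] Lp (Vec N) ∞ μ) : Prop where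
  leibniz : ∀ f g : 𝒜, ∀ᵐ x ∂μ,
    D (f * g) x = (f : C(X, ℝ)) x • D g x + (g : C(X, ℝ)) x • D f x
  locality : ∀ f : 𝒜, ∀ K ∈ localitySets μ, ∀ c : ℝ,
    (∀ x ∈ K, (f : C(X, ℝ)) x = c) → ∀ᵐ x ∂μ, x ∈ K → D f x = 0

end Space

section Gradient

variable {X : Type*} [MetricSpace X] [MeasurableSpace X]
  {μ : Measure X} {𝒜 : Subalgebra ℝ C(X, ℝ)} {N : ℕ}

/-- The matrix field with rows `D u₁, …, D u_m`. -/
noncomputable def gradFun (D : 𝒜 →ₗ[ℝ] Lp (Vec N) ∞ μ) {m : ℕ} (u : Fin m → 𝒜) (x : X) : Mat m N :=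
  WithLp.toLp 2 (fun i => D (u i) x)

theorem memLp_gradFun (D : 𝒜 →ₗ[ℝ] Lp (Vec N) ∞ μ) {m : ℕ} (u : Fin m → 𝒜) :
    MemLp (gradFun D u) ∞ μ :=
  MemLp.of_eval_piLp (fun i => Lp.memLp (D (u i)))

theorem gradFun_add (D : 𝒜 →ₗ[ℝ] Lp (Vec N) ∞ μ) {m : ℕ} (u v : Fin m → 𝒜) :
    gradFun D (u + v) =ᵐ[μ] gradFun D u + gradFun D v := by
  have h : ∀ᵐ x ∂μ, ∀ i, D (u i + v i) x = D (u i) x + D (v i) x := by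
    rw [ae_all_iff]
    intro i
    rw [map_add]
    exact Lp.coeFn_add _ _
  filter_upwards [h] with x hx
  have hx' : gradFun D (u + v) x = gradFun D u x + gradFun D v x := by
    ext i j
    simpa [gradFun, -map_add] using congrArg (fun y : Vec N => y j) (hx i)
  exact hx'

theorem gradFun_smul (D : 𝒜 →ₗ[ℝ] Lp (Vec N) ∞ μ) {m : ℕ} (c : ℝ) (u : Fin m → 𝒜) :
    gradFun D (c • u) =ᵐ[μ] c • gradFun D u := by
  have h : ∀ᵐ x ∂μ, ∀ i, D (c • u i) x = c • D (u i) x := by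
    rw [ae_all_iff]
    intro i
    rw [map_smul]
    exact Lp.coeFn_smul _ _
  filter_upwards [h] with x hx
  have hx' : gradFun D (c • u) x = c • gradFun D u x := by
    ext i j
    simpa [gradFun, -map_smul] using congrArg (fun y : Vec N => y j) (hx i)
  exact hx'

/-- The operator `∇ : 𝒜(X; ℝᵐ) → L^∞_μ(X; 𝕄^{m×N})`, where `𝒜(X; ℝᵐ) = 𝒜(X)ᵐ`. -/
noncomputable def grad (D : 𝒜 →ₗ[ℝ] Lp (Vec N) ∞ μ) (m : ℕ) :
    (Fin m → 𝒜) →ₗ[ℝ] Lp (Mat m N) ∞ μ where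
  toFun u := (memLp_gradFun D u).toLp (gradFun D u)
  map_add' u v := by
    rw [← MemLp.toLp_add]
    exact MemLp.toLp_congr _ _ (gradFun_add D u v)
  map_smul' c u := by
    rw [RingHom.id_apply, ← MemLp.toLp_const_smul]
    exact MemLp.toLp_congr _ _ (gradFun_smul D c u)

/-- `𝒜_u^m`: the `v ∈ 𝒜(X; ℝᵐ)` that agree with `u` on the support of `μ`. -/
def agreeOnSupport (μ : Measure X) {m : ℕ} (u : Fin m → 𝒜) : Set (Fin m → 𝒜) :=
  {v | ∀ x ∈ μ.support, ∀ i, (v i : C(X, ℝ)) x = (u i : C(X, ℝ)) x}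

/-- `ℋ_0^m`: the gradients, in `L^∞_μ`, of the `v ∈ 𝒜(X; ℝᵐ)` that vanish on the support of `μ`. -/
def normalFields (D : 𝒜 →ₗ[ℝ] Lp (Vec N) ∞ μ) (m : ℕ) : Set (Lp (Mat m N) ∞ μ) :=
  grad D m '' agreeOnSupport μ (0 : Fin m → 𝒜)

end Gradient

section FiniteDimensional

set_option linter.unusedSectionVars false

variable {E : Type*} [NormedAddCommGroup E] [InnerProductSpace ℝ E] [FiniteDimensional ℝ E]

theorem closure_subset_span (S : Set E) : closure S ⊆ (Submodule.span ℝ S : Set E) :=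
  closure_minimal Submodule.subset_span (Submodule.closed_of_finiteDimensional _)

theorem span_subset_closure (S : Set E) (h0 : (0 : E) ∈ closure S)
    (hadd : ∀ a ∈ S, ∀ b ∈ S, a + b ∈ closure S)
    (hsmul : ∀ (q : ℚ), ∀ a ∈ S, (q : ℝ) • a ∈ closure S) :
    (Submodule.span ℝ S : Set E) ⊆ closure S := by
  have cadd : ∀ a ∈ closure S, ∀ b ∈ closure S, a + b ∈ closure S := by
    intro a ha b hb
    have := map_mem_closure₂ (f := fun a b : E => a + b) (u := closure S) continuous_add ha hb hadd
    rwa [closure_closure] at this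
  have csmul : ∀ (c : ℝ), ∀ a ∈ closure S, c • a ∈ closure S := by
    intro c a ha
    have hc : c ∈ closure (Set.range ((↑) : ℚ → ℝ)) := Rat.denseRange_cast c
    have := map_mem_closure₂ (f := fun (c : ℝ) (a : E) => c • a) (u := closure S)
      continuous_smul hc ha (by rintro _ ⟨q, rfl⟩ b hb; exact hsmul q b hb)
    rwa [closure_closure] at this
  intro y hy
  refine Submodule.span_induction (p := fun y _ => y ∈ closure S) ?_ h0 ?_ ?_ hy
  · exact fun y hy => subset_closure hy
  · exact fun a b _ _ ha hb => cadd a ha b hb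
  · exact fun c a _ ha => csmul c a ha

theorem aestronglyMeasurable_gramSchmidt {X : Type*} [MeasurableSpace X] {μ : Measure X}
    (f : ℕ → X → E) (hf : ∀ n, AEStronglyMeasurable (f n) μ) (n : ℕ) :
    AEStronglyMeasurable (fun x => InnerProductSpace.gramSchmidt ℝ (fun k => f k x) n) μ := by
  induction n using Nat.strong_induction_on with
  | _ n ih =>
    have heq : (fun x => InnerProductSpace.gramSchmidt ℝ (fun k => f k x) n) = fun x =>
        f n x - ∑ i ∈ Finset.Iio n,
          (inner ℝ (InnerProductSpace.gramSchmidt ℝ (fun k => f k x) i) (f n x) /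
            ‖InnerProductSpace.gramSchmidt ℝ (fun k => f k x) i‖ ^ 2) •
            InnerProductSpace.gramSchmidt ℝ (fun k => f k x) i := by
      funext x
      rw [InnerProductSpace.gramSchmidt_def]
      simp only [Submodule.starProjection_singleton]
      rfl
    rw [heq]
    refine (hf n).sub (Finset.aestronglyMeasurable_fun_sum _ fun i hi => ?_)
    have hi := ih i (Finset.mem_Iio.1 hi)
    refine AEStronglyMeasurable.smul ?_ hi
    refine AEMeasurable.aestronglyMeasurable ?_
    exact (hi.inner (hf n)).aemeasurable.div (hi.norm.aemeasurable.pow_const 2)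

theorem gramSchmidt_eq_starProjection (w : ℕ → E) (n : ℕ) :
    InnerProductSpace.gramSchmidt ℝ w n =
      (Submodule.span ℝ (w '' Set.Iio n))ᗮ.starProjection (w n) := by
  refine (Submodule.eq_starProjection_of_mem_orthogonal ?_ ?_).symm
  · rw [← InnerProductSpace.span_gramSchmidt_Iio ℝ w n, Submodule.mem_orthogonal]
    intro y hy
    induction hy using Submodule.span_induction with
    | mem y hy =>
      obtain ⟨i, hi, rfl⟩ := hy
      exact InnerProductSpace.gramSchmidt_orthogonal ℝ w (ne_of_lt hi)
    | zero => simp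
    | add a b _ _ ha hb => rw [inner_add_left, ha, hb, add_zero]
    | smul c a _ ha => rw [inner_smul_left, ha, mul_zero]
  · rw [Submodule.orthogonal_orthogonal, ← InnerProductSpace.span_gramSchmidt_Iio ℝ w n,
      InnerProductSpace.gramSchmidt_def, sub_sub_cancel]
    refine Submodule.sum_mem _ fun i hi => ?_
    rw [Submodule.starProjection_singleton]
    exact Submodule.smul_mem _ _ (Submodule.subset_span ⟨i, Finset.mem_Iio.1 hi, rfl⟩)

/-- The projection onto the orthogonal complement of a span of measurable fields is measurable. -/
theorem aestronglyMeasurable_starProjection {X : Type*} [MeasurableSpace X] {μ : Measure X}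
    (w : ℕ → X → E) (g : X → E) (hw : ∀ n, AEStronglyMeasurable (w n) μ)
    (hg : AEStronglyMeasurable g μ) :
    AEStronglyMeasurable
      (fun x => (Submodule.span ℝ (Set.range fun n => w n x))ᗮ.starProjection (g x)) μ := by
  let W : ℕ → X → Submodule ℝ E := fun n x => Submodule.span ℝ ((fun k => w k x) '' Set.Iio n)
  have hmono : ∀ x, Monotone (fun n => W n x) := fun x a b hab =>
    Submodule.span_mono (Set.image_mono (Set.Iio_subset_Iio hab))
  have hsup : ∀ x, ⨆ n, W n x = Submodule.span ℝ (Set.range fun n => w n x) := by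
    intro x
    rw [← Submodule.span_iUnion, ← Set.image_iUnion, Set.iUnion_Iio, Set.image_univ]
  have hlim : ∀ x, Tendsto (fun n => (W n x)ᗮ.starProjection (g x)) atTop
      (𝓝 ((Submodule.span ℝ (Set.range fun n => w n x))ᗮ.starProjection (g x))) := by
    intro x
    have h := Submodule.starProjection_tendsto_closure_iSup (fun n => W n x) (hmono x) (g x)
    have hcl : (⨆ n, W n x).topologicalClosure = Submodule.span ℝ (Set.range fun n => w n x) := by
      rw [hsup]
      exact (Submodule.closed_of_finiteDimensional _).submodule_topologicalClosure_eq
    rw [Submodule.starProjection_orthogonal_val]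
    simp_rw [Submodule.starProjection_orthogonal_val]
    simp_rw [hcl] at h
    exact tendsto_const_nhds.sub h
  refine aestronglyMeasurable_of_tendsto_ae atTop (fun n => ?_) (ae_of_all _ hlim)
  have key : (fun x => (W n x)ᗮ.starProjection (g x)) = fun x =>
      InnerProductSpace.gramSchmidt ℝ (fun k => (if k < n then w k else g) x) n := by
    funext x
    rw [gramSchmidt_eq_starProjection]
    have h1 : (fun k => (if k < n then w k else g) x) '' Set.Iio n = (fun k => w k x) '' Set.Iio n :=
      Set.image_congr fun k hk => by simp [Set.mem_Iio.1 hk]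
    simp [W, h1]
  rw [key]
  refine aestronglyMeasurable_gramSchmidt _ (fun k => ?_) n
  split_ifs
  · exact hw k
  · exact hg

end FiniteDimensional

section Normal

variable {X : Type*} [MetricSpace X] [CompactSpace X] [MeasurableSpace X] [BorelSpace X]
  {μ : Measure X} [IsFiniteMeasure μ] {𝒜 : Subalgebra ℝ C(X, ℝ)} {N : ℕ}

/-- There is a sequence in `ℋ_0^m` whose values are, almost everywhere, dense among the values of
each element of `ℋ_0^m`. -/
theorem exists_normalSeq (D : 𝒜 →ₗ[ℝ] Lp (Vec N) ∞ μ) (m : ℕ) :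
    ∃ w : ℕ → Lp (Mat m N) ∞ μ, (∀ n, w n ∈ normalFields D m) ∧
      ∀ v ∈ normalFields D m, ∀ᵐ x ∂μ, v x ∈ closure (Set.range fun n => w n x) := by
  have hmem : ∀ v : Lp (Mat m N) ∞ μ, MemLp v 1 μ := fun v => (Lp.memLp v).mono_exponent le_top
  let T : normalFields D m → Lp (Mat m N) 1 μ := fun v => (hmem v).toLp _
  have : Fact ((1 : ℝ≥0∞) ≠ ∞) := ⟨ENNReal.one_ne_top⟩
  have : Nonempty (Set.range T) :=
    ⟨T ⟨grad D m 0, 0, fun _ _ _ => rfl, rfl⟩, Set.mem_range_self _⟩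
  have hs := TopologicalSpace.denseRange_denseSeq (Set.range T)
  set s := TopologicalSpace.denseSeq (Set.range T)
  choose w hw using fun n => (s n).2
  refine ⟨fun n => w n, fun n => (w n).2, fun v hv => ?_⟩
  have h1 : (⟨T ⟨v, hv⟩, Set.mem_range_self _⟩ : Set.range T) ∈ closure (Set.range s) := hs _
  obtain ⟨y, hy, hlim⟩ := mem_closure_iff_seq_limit.1 h1
  choose k hk using hy
  have h2 : Tendsto (fun n => T (w (k n))) atTop (𝓝 (T ⟨v, hv⟩)) := by
    have := (continuous_subtype_val.tendsto _).comp hlim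
    refine this.congr fun n => ?_
    rw [hw, hk]
    rfl
  obtain ⟨φ, -, hφ⟩ := (tendstoInMeasure_of_tendsto_Lp h2).exists_seq_tendsto_ae
  have h3 : ∀ᵐ x ∂μ, ∀ n, T (w n) x = (w n : Lp (Mat m N) ∞ μ) x :=
    ae_all_iff.2 fun n => MemLp.coeFn_toLp _
  have h4 : ∀ᵐ x ∂μ, T ⟨v, hv⟩ x = v x := MemLp.coeFn_toLp _
  filter_upwards [hφ, h3, h4] with x hx h3x h4x
  rw [h4x] at hx
  refine mem_closure_of_tendsto hx (Eventually.of_forall fun n => ?_)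
  exact ⟨k (φ n), (h3x _).symm⟩

/-- A sequence in `ℋ_0^m` as in `exists_normalSeq`. -/
noncomputable def normalSeq (D : 𝒜 →ₗ[ℝ] Lp (Vec N) ∞ μ) (m : ℕ) : ℕ → Lp (Mat m N) ∞ μ :=
  (exists_normalSeq D m).choose

/-- The normal space `N_μ^m(x)`, the set of the values `w(x)` with `w ∈ ℋ_0^m`. Elements of `ℋ_0^m`
are classes of functions, so that this is a family of sets defined up to equality almost everywhere,
namely the `μ`-essential supremum of `ℋ_0^m`; it is realized here by means of a sequence.
`normalSpace_contains` and `normalSpace_minimal` characterize it, up to equality almost everywhere,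
independently of the sequence and of the choice of representatives. -/
noncomputable def normalSpace (D : 𝒜 →ₗ[ℝ] Lp (Vec N) ∞ μ) (m : ℕ) (x : X) :
    Submodule ℝ (Mat m N) :=
  Submodule.span ℝ (Set.range fun n => normalSeq D m n x)

theorem normalSpace_contains (D : 𝒜 →ₗ[ℝ] Lp (Vec N) ∞ μ) (m : ℕ) :
    ∀ w ∈ normalFields D m, ∀ᵐ x ∂μ, w x ∈ normalSpace D m x := by
  intro w hw
  filter_upwards [(exists_normalSeq D m).choose_spec.2 w hw] with x hx
  exact closure_subset_span _ hx

theorem normalSpace_minimal (D : 𝒜 →ₗ[ℝ] Lp (Vec N) ∞ μ) (m : ℕ) (Γ : X → Set (Mat m N))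
    (hclosed : ∀ᵐ x ∂μ, IsClosed (Γ x)) (hΓ : ∀ w ∈ normalFields D m, ∀ᵐ x ∂μ, w x ∈ Γ x) :
    ∀ᵐ x ∂μ, (normalSpace D m x : Set (Mat m N)) ⊆ Γ x := by
  set w := normalSeq D m with hw_def
  have hw : ∀ n, w n ∈ normalFields D m := (exists_normalSeq D m).choose_spec.1
  have hd : ∀ v ∈ normalFields D m, ∀ᵐ x ∂μ, v x ∈ closure (Set.range fun n => w n x) :=
    (exists_normalSeq D m).choose_spec.2
  have hadd : ∀ a ∈ normalFields D m, ∀ b ∈ normalFields D m, a + b ∈ normalFields D m := by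
    rintro _ ⟨u, hu, rfl⟩ _ ⟨v, hv, rfl⟩
    refine ⟨u + v, fun x hx i => ?_, map_add _ _ _⟩
    have h1 := hu x hx i
    have h2 := hv x hx i
    simp at h1 h2
    simp [h1, h2]
  have hsmul : ∀ c : ℝ, ∀ a ∈ normalFields D m, c • a ∈ normalFields D m := by
    rintro c _ ⟨u, hu, rfl⟩
    refine ⟨c • u, fun x hx i => ?_, map_smul _ _ _⟩
    have h1 := hu x hx i
    simp at h1
    simp [h1]
  have hA : ∀ᵐ x ∂μ, ∀ i j, w i x + w j x ∈ closure (Set.range fun n => w n x) := by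
    rw [ae_all_iff]; intro i; rw [ae_all_iff]; intro j
    filter_upwards [hd _ (hadd _ (hw i) _ (hw j)), Lp.coeFn_add (w i) (w j)] with x hx h
    rw [h] at hx
    exact hx
  have hS : ∀ᵐ x ∂μ, ∀ (q : ℚ) (i : ℕ), (q : ℝ) • w i x ∈ closure (Set.range fun n => w n x) := by
    rw [ae_all_iff]; intro q; rw [ae_all_iff]; intro i
    filter_upwards [hd _ (hsmul (q : ℝ) _ (hw i)), Lp.coeFn_smul (q : ℝ) (w i)] with x hx h
    rw [h] at hx
    exact hx
  have hG : ∀ᵐ x ∂μ, ∀ n, w n x ∈ Γ x := ae_all_iff.2 fun n => hΓ _ (hw n)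
  have h0 : (0 : Lp (Mat m N) ∞ μ) ∈ normalFields D m := by
    simpa using hsmul 0 _ (hw 0)
  filter_upwards [hclosed, hA, hS, hG, hd 0 h0, Lp.coeFn_zero (Mat m N) ∞ μ]
    with x hcx hAx hSx hGx h0x hz
  have hcl : closure (Set.range fun n => w n x) ⊆ Γ x :=
    closure_minimal (by rintro _ ⟨n, rfl⟩; exact hGx n) hcx
  refine Set.Subset.trans ?_ hcl
  rw [hz] at h0x
  exact span_subset_closure _ h0x (by rintro _ ⟨i, rfl⟩ _ ⟨j, rfl⟩; exact hAx i j)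
    (by rintro q _ ⟨i, rfl⟩; exact hSx q i)

/-- The tangent space `T_μ^m(x)`, the orthogonal complement of the normal space. -/
noncomputable def tangentSpace (D : 𝒜 →ₗ[ℝ] Lp (Vec N) ∞ μ) (m : ℕ) (x : X) :
    Submodule ℝ (Mat m N) :=
  (normalSpace D m x)ᗮ

/-- The pointwise formula `∇_μ u(x) = P_μ^m(x)(∇u(x))`, where `P_μ^m(x)` is the orthogonal
projection onto the tangent space. -/
noncomputable def muGradFun (D : 𝒜 →ₗ[ℝ] Lp (Vec N) ∞ μ) {m : ℕ} (u : Fin m → 𝒜) (x : X) :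
    Mat m N :=
  (tangentSpace D m x).starProjection (grad D m u x)

theorem aestronglyMeasurable_muGradFun (D : 𝒜 →ₗ[ℝ] Lp (Vec N) ∞ μ) {m : ℕ} (u : Fin m → 𝒜) :
    AEStronglyMeasurable (muGradFun D u) μ :=
  aestronglyMeasurable_starProjection (fun n => normalSeq D m n) (grad D m u)
    (fun _ => Lp.aestronglyMeasurable _) (Lp.aestronglyMeasurable _)

theorem memLp_muGradFun (D : 𝒜 →ₗ[ℝ] Lp (Vec N) ∞ μ) {m : ℕ} (p : ℝ≥0∞) (u : Fin m → 𝒜) :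
    MemLp (muGradFun D u) p μ :=
  ((Lp.memLp (grad D m u)).mono (aestronglyMeasurable_muGradFun D u)
    (ae_of_all _ fun _ => Submodule.norm_starProjection_apply_le _ _)).mono_exponent le_top

/-- The `μ`-gradient `∇_μ` on `𝒜(X; ℝᵐ)`, with values in `L^p_μ(X; 𝕄^{m×N})` (`1 ≤ p ≤ ∞`). -/
noncomputable def muGrad (D : 𝒜 →ₗ[ℝ] Lp (Vec N) ∞ μ) (m : ℕ) (p : ℝ≥0∞) :
    (Fin m → 𝒜) →ₗ[ℝ] Lp (Mat m N) p μ where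
  toFun u := (memLp_muGradFun D p u).toLp (muGradFun D u)
  map_add' u v := by
    rw [← MemLp.toLp_add]
    refine MemLp.toLp_congr _ _ ?_
    filter_upwards [Lp.coeFn_add (grad D m u) (grad D m v)] with x hx
    simp only [muGradFun, Pi.add_apply, map_add] at hx ⊢
    rw [hx]
    exact map_add _ _ _
  map_smul' c u := by
    rw [RingHom.id_apply, ← MemLp.toLp_const_smul]
    refine MemLp.toLp_congr _ _ ?_
    filter_upwards [Lp.coeFn_smul c (grad D m u)] with x hx
    simp only [muGradFun, Pi.smul_apply, map_smul] at hx ⊢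
    rw [hx]
    exact map_smul _ _ _

/-- The `ℝᵐ`-valued continuous function with components `u₁, …, u_m`. -/
def toContinuousMap {m : ℕ} : (Fin m → 𝒜) →ₗ[ℝ] C(X, Vec m) where
  toFun u := ⟨fun x => WithLp.toLp 2 (fun i => (u i : C(X, ℝ)) x), by fun_prop⟩
  map_add' u v := by ext; simp
  map_smul' c u := by ext; simp

/-- The class of `u ∈ 𝒜(X; ℝᵐ)` in `L^p_μ(X; ℝᵐ)`. -/
noncomputable def toLpClass (μ : Measure X) [IsFiniteMeasure μ] (m : ℕ) (p : ℝ≥0∞)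
    [Fact (1 ≤ p)] : (Fin m → 𝒜) →ₗ[ℝ] Lp (Vec m) p μ :=
  (ContinuousMap.toLp p μ ℝ : C(X, Vec m) →L[ℝ] Lp (Vec m) p μ).toLinearMap ∘ₗ toContinuousMap

/-- The map `u ↦ (u, ∇_μ u)`; the target carries the norm `‖u‖_{L^p_μ} + ‖v‖_{L^p_μ}`. -/
noncomputable def sobolevGraph (D : 𝒜 →ₗ[ℝ] Lp (Vec N) ∞ μ) (m : ℕ) (p : ℝ≥0∞) [Fact (1 ≤ p)] :
    (Fin m → 𝒜) →ₗ[ℝ] WithLp 1 (Lp (Vec m) p μ × Lp (Mat m N) p μ) :=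
  (WithLp.linearEquiv 1 ℝ (Lp (Vec m) p μ × Lp (Mat m N) p μ)).symm.toLinearMap ∘ₗ
    (toLpClass μ m p).prod (muGrad D m p)

/-- The Sobolev space `W^{1,p}_μ(X; ℝᵐ)`, the completion of `𝒜(X; ℝᵐ)` for the norm
`‖u‖_{L^p_μ} + ‖∇_μ u‖_{L^p_μ}`. It is realized as the closure, in a complete space, of the
isometric image of `𝒜(X; ℝᵐ)` under `u ↦ (u, ∇_μ u)`; an element is a pair (the function in `L^p_μ`,
its `μ`-gradient). -/
noncomputable def sobolevSpace (D : 𝒜 →ₗ[ℝ] Lp (Vec N) ∞ μ) (m : ℕ) (p : ℝ≥0∞) [Fact (1 ≤ p)] :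
    Submodule ℝ (WithLp 1 (Lp (Vec m) p μ × Lp (Mat m N) p μ)) :=
  (LinearMap.range (sobolevGraph D m p)).topologicalClosure

/-- A field of Carathéodory integrands over `X`. -/
structure IsCaratheodory (μ : Measure X) {m : ℕ} (L : X → Mat m N → ℝ≥0∞) : Prop where
  continuous : ∀ᵐ x ∂μ, Continuous (L x)
  aemeasurable : ∀ ξ, AEMeasurable (fun x => L x ξ) μ

/-- `p`-polynomial growth: `L_x(ξ) ≤ c (1 + |ξ|^p)`. -/
def HasPolynomialGrowth (μ : Measure X) {m : ℕ} (p : ℝ≥0∞) (L : X → Mat m N → ℝ≥0∞) : Prop :=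
  ∃ c : ℝ, 0 < c ∧ ∀ᵐ x ∂μ, ∀ ξ, L x ξ ≤ ENNReal.ofReal (c * (1 + ‖ξ‖ ^ p.toReal))

/-- The variational integral `E(u; A) = ∫_A L_x(∇u(x)) dμ(x)`. -/
noncomputable def energy (D : 𝒜 →ₗ[ℝ] Lp (Vec N) ∞ μ) {m : ℕ} (L : X → Mat m N → ℝ≥0∞)
    (u : Fin m → 𝒜) (A : Set X) : ℝ≥0∞ :=
  ∫⁻ x in A, L x (grad D m u x) ∂μ

/-- `L̂_x : T_μ^m(x) → [0, ∞]`, `L̂_x(ξ) = inf {L_x(ξ + ζ) : ζ ∈ N_μ^m(x)}`. -/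
noncomputable def hatL (D : 𝒜 →ₗ[ℝ] Lp (Vec N) ∞ μ) {m : ℕ} (L : X → Mat m N → ℝ≥0∞) (x : X)
    (ξ : tangentSpace D m x) : ℝ≥0∞ :=
  ⨅ ζ : normalSpace D m x, L x ((ξ : Mat m N) + (ζ : Mat m N))

/-- The variational integral `Ê(u; A) = ∫_A L̂_x(∇_μ u(x)) dμ(x)`. -/
noncomputable def hatEnergy (D : 𝒜 →ₗ[ℝ] Lp (Vec N) ∞ μ) {m : ℕ} (L : X → Mat m N → ℝ≥0∞)
    (u : Fin m → 𝒜) (A : Set X) : ℝ≥0∞ :=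
  ∫⁻ x in A, hatL D L x ⟨muGradFun D u x, Submodule.starProjection_apply_mem _ _⟩ ∂μ

/-- The `L^p_μ`-relaxation over `𝒜(X; ℝᵐ)` of a functional `F`, at `u ∈ L^p_μ(X; ℝᵐ)`: the infimum of
`liminf F(uₙ)` over all sequences `uₙ ∈ 𝒜(X; ℝᵐ)` that converge to `u` in `L^p_μ(X; ℝᵐ)`. -/
noncomputable def relaxation {m : ℕ} {p : ℝ≥0∞} [Fact (1 ≤ p)] (F : (Fin m → 𝒜) → ℝ≥0∞)
    (u : Lp (Vec m) p μ) : ℝ≥0∞ :=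
  ⨅ (v : ℕ → Fin m → 𝒜) (_ : Tendsto (fun n => toLpClass μ m p (v n)) atTop (𝓝 u)),
    liminf (fun n => F (v n)) atTop

end Normal

end MetricRelax

/-!
The two functionals have the same relaxation because the energy of a map can be lowered to its hat
energy without changing the map on the support of `μ`, hence without changing its class in `L^p_μ`.

One inequality is pointwise: `∇u` and `∇_μ u` differ by a normal vector, so
`L̂_x(∇_μ u) ≤ L_x(∇u)` (`hatEnergy_le_energy`).

For the other one, the normal space is the closure of the values of a sequence of gradients `∇vₙ`
with `vₙ = 0` on the support, so that `L̂_x(∇_μ u) = infₙ L_x(∇u + ∇vₙ)` almost everywhere by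
continuity of `L_x`. Two maps that agree on the support can be glued by a Urysohn function `φ`: the
term of the Leibniz rule that contains `D φ` is multiplied by a function vanishing on the support, so
the gradient of `u + φ (v - u)` is `∇u + φ (∇v - ∇u)` (`grad_glue`), whatever the size of `D φ`.
Choosing `φ` close to the indicator function of the set where `v` has the lower density realizes the
minimum of finitely many densities up to a small set (`exists_le_of_finitely_many`). Since gluing does
not increase the bound on the gradients, the growth condition controls the energy on the exceptional
set, and monotone convergence passes to the infimum over all `n`
(`exists_energy_le_lintegral_iInf_add`, `exists_energy_le_hatEnergy_add`).
-/

namespace MetricRelax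

/-! ### Gluing maps that agree on the support of the measure -/

section Gluing

variable {X : Type*} [MetricSpace X] [MeasurableSpace X] {μ : Measure X}
  {𝒜 : Subalgebra ℝ C(X, ℝ)} {m N : ℕ}

theorem ae_norm_grad_le (D : 𝒜 →ₗ[ℝ] Lp (Vec N) ∞ μ) (u : Fin m → 𝒜) :
    ∀ᵐ x ∂μ, ‖grad D m u x‖ ≤ ‖grad D m u‖ := by
  have h := enorm_ae_le_eLpNormEssSup (grad D m u) μ
  filter_upwards [h] with x hx
  rw [Lp.norm_def, eLpNorm_exponent_top, ← toReal_enorm]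
  refine ENNReal.toReal_mono ?_ hx
  have := Lp.eLpNorm_ne_top (grad D m u)
  rwa [eLpNorm_exponent_top] at this

/-- Interpolation `u + φ (v - u)` of two maps, componentwise. -/
def glue (φ : 𝒜) (u v : Fin m → 𝒜) : Fin m → 𝒜 := fun i => u i + φ * (v i - u i)

theorem glue_mem_agreeOnSupport (φ : 𝒜) {u v w : Fin m → 𝒜} (hu : u ∈ agreeOnSupport μ w)
    (hv : v ∈ agreeOnSupport μ w) : glue φ u v ∈ agreeOnSupport μ w := by
  intro x hx i
  simp [glue, hu x hx i, hv x hx i]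

/-- If `u` and `v` agree on the support, the Leibniz rule leaves no term containing `D φ`. -/
theorem grad_glue [CompactSpace X] {D : 𝒜 →ₗ[ℝ] Lp (Vec N) ∞ μ} (hD : IsGradientOperator μ D)
    (φ : 𝒜) {u v : Fin m → 𝒜} (huv : v ∈ agreeOnSupport μ u) :
    ∀ᵐ x ∂μ, grad D m (glue φ u v) x =
      grad D m u x + (φ : C(X, ℝ)) x • (grad D m v x - grad D m u x) := by
  have hg : ∀ w : Fin m → 𝒜, ∀ᵐ x ∂μ, grad D m w x = gradFun D w x := fun w =>
    MemLp.coeFn_toLp (memLp_gradFun D w)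
  have h : ∀ᵐ x ∂μ, ∀ i, D (glue φ u v i) x =
      D (u i) x + (φ : C(X, ℝ)) x • (D (v i) x - D (u i) x) := by
    rw [ae_all_iff]
    intro i
    have h1 := Lp.coeFn_add (D (u i)) (D (φ * (v i - u i)))
    have h2 := Lp.coeFn_sub (D (v i)) (D (u i))
    rw [← map_add] at h1
    rw [← map_sub] at h2
    filter_upwards [h1, h2, hD.leibniz φ (v i - u i), μ.support_mem_ae] with x h1x h2x h3x hx
    have h0 : ((v i - u i : 𝒜) : C(X, ℝ)) x = 0 := by
      simp [huv x hx i]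
    rw [glue, h1x, Pi.add_apply, h3x, h2x, h0, zero_smul, add_zero, Pi.sub_apply]
  filter_upwards [h, hg u, hg v, hg (glue φ u v)] with x hx hux hvx hgx
  rw [hux, hvx, hgx]
  ext i j
  simpa [gradFun] using congrArg (fun y : Vec N => y j) (hx i)

theorem toLpClass_eq_of_agreeOnSupport [CompactSpace X] [BorelSpace X] [IsFiniteMeasure μ]
    {p : ℝ≥0∞} [Fact (1 ≤ p)] {u v : Fin m → 𝒜} (hv : v ∈ agreeOnSupport μ u) :
    toLpClass μ m p v = toLpClass μ m p u := by
  refine Lp.ext ?_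
  have h1 := ContinuousMap.coeFn_toLp (p := p) (𝕜 := ℝ) μ (toContinuousMap v)
  have h2 := ContinuousMap.coeFn_toLp (p := p) (𝕜 := ℝ) μ (toContinuousMap u)
  refine h1.trans (EventuallyEq.trans ?_ h2.symm)
  filter_upwards [μ.support_mem_ae] with x hx
  ext i
  exact hv x hx i

end Gluing

/-! ### Superposition with a Carathéodory integrand -/

section Integrand

variable {X : Type*} [MeasurableSpace X] {μ : Measure X} {m N : ℕ} {L : X → Mat m N → ℝ≥0∞}

/-- Superposition of a Carathéodory integrand with a measurable field, by approximation of the field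
by simple ones. -/
theorem IsCaratheodory.aemeasurable_comp (hL : IsCaratheodory μ L) {g : X → Mat m N}
    (hg : AEStronglyMeasurable g μ) : AEMeasurable (fun x => L x (g x)) μ := by
  obtain ⟨g', hg', hgg'⟩ := hg
  have hsimple : ∀ s : SimpleFunc X (Mat m N), AEMeasurable (fun x => L x (s x)) μ := by
    intro s
    have heq : (fun x => L x (s x)) = fun x =>
        ∑ ξ ∈ s.range, (s ⁻¹' {ξ}).indicator (fun x => L x ξ) x := by
      funext x
      rw [Finset.sum_eq_single (s x)]
      · simp
      · intro ξ _ hξ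
        exact Set.indicator_of_notMem (fun h => hξ (Eq.symm h)) _
      · intro h
        exact absurd (s.mem_range_self x) h
    rw [heq]
    exact Finset.aemeasurable_fun_sum _ fun ξ _ =>
      (hL.aemeasurable ξ).indicator (s.measurableSet_fiber ξ)
  have h' : AEMeasurable (fun x => L x (g' x)) μ := by
    refine aemeasurable_of_tendsto_metrizable_ae atTop (fun n => hsimple (hg'.approx n)) ?_
    filter_upwards [hL.continuous] with x hx
    exact (hx.tendsto _).comp (hg'.tendsto_approx x)
  refine h'.congr ?_
  filter_upwards [hgg'] with x hx
  rw [hx]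

end Integrand

/-! ### Comparison of the two energies -/

section Relaxation

variable {X : Type*} [MetricSpace X] [CompactSpace X] [MeasurableSpace X] [BorelSpace X]
  {μ : Measure X} [IsFiniteMeasure μ] {𝒜 : Subalgebra ℝ C(X, ℝ)} {m N : ℕ}
  {D : 𝒜 →ₗ[ℝ] Lp (Vec N) ∞ μ} {L : X → Mat m N → ℝ≥0∞}

/-- Up to a set of small measure, the smaller of the energy densities of two maps that agree on the
support is attained by a third such map, without increase of the bound on the gradients. -/
theorem exists_glue_le_min (h𝒜 : UrysohnProperty 𝒜) (hD : IsGradientOperator μ D)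
    (hL : IsCaratheodory μ L) {w u v : Fin m → 𝒜} (hu : u ∈ agreeOnSupport μ w)
    (hv : v ∈ agreeOnSupport μ w) {M : ℝ} (huM : ∀ᵐ x ∂μ, ‖grad D m u x‖ ≤ M)
    (hvM : ∀ᵐ x ∂μ, ‖grad D m v x‖ ≤ M) {δ : ℝ≥0∞} (hδ : δ ≠ 0) :
    ∃ z ∈ agreeOnSupport μ w, (∀ᵐ x ∂μ, ‖grad D m z x‖ ≤ M) ∧ ∃ B : Set X, MeasurableSet B ∧
      μ B ≤ δ ∧ ∀ᵐ x ∂μ, x ∉ B →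
        L x (grad D m z x) ≤ L x (grad D m u x) ∧ L x (grad D m z x) ≤ L x (grad D m v x) := by
  have hδ2 : δ / 2 ≠ 0 := by simpa using hδ
  have hfu := hL.aemeasurable_comp (Lp.aestronglyMeasurable (grad D m u))
  have hfv := hL.aemeasurable_comp (Lp.aestronglyMeasurable (grad D m v))
  set S : Set X := {x | hfv.mk _ x < hfu.mk _ x} with hS_def
  have hS : MeasurableSet S := measurableSet_lt hfv.measurable_mk hfu.measurable_mk
  obtain ⟨K₁, hK₁S, hK₁, hμ₁⟩ := hS.exists_isCompact_sdiff_lt (measure_ne_top μ _) hδ2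
  obtain ⟨K₂, hK₂S, hK₂, hμ₂⟩ := hS.compl.exists_isCompact_sdiff_lt (measure_ne_top μ _) hδ2
  obtain ⟨φ, hφ, hφI, hφ0, hφ1⟩ := h𝒜 K₁ K₂ᶜ hK₁ hK₂.isClosed.isOpen_compl
    (fun x hx hx2 => hK₂S hx2 (hK₁S hx))
  have hgrad := grad_glue hD ⟨φ, hφ⟩ (u := u) (v := v) (m := m)
    (fun x hx i => (hv x hx i).trans (hu x hx i).symm)
  refine ⟨glue ⟨φ, hφ⟩ u v, glue_mem_agreeOnSupport _ hu hv, ?_, (S \ K₁) ∪ (Sᶜ \ K₂),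
    (hS.diff hK₁.measurableSet).union (hS.compl.diff hK₂.measurableSet), ?_, ?_⟩
  · -- the gradient of the interpolation is a pointwise convex combination
    filter_upwards [hgrad, huM, hvM] with x hx hux hvx
    rw [hx]
    have := (convex_closedBall (0 : Mat m N) M).add_smul_sub_mem
      (mem_closedBall_zero_iff.2 hux) (mem_closedBall_zero_iff.2 hvx) (hφI x)
    exact mem_closedBall_zero_iff.1 this
  · calc μ ((S \ K₁) ∪ (Sᶜ \ K₂)) ≤ μ (S \ K₁) + μ (Sᶜ \ K₂) := measure_union_le _ _
      _ ≤ δ / 2 + δ / 2 := add_le_add hμ₁.le hμ₂.le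
      _ = δ := ENNReal.add_halves δ
  · filter_upwards [hgrad, hfu.ae_eq_mk, hfv.ae_eq_mk] with x hx hux hvx hxB
    by_cases hxS : x ∈ S
    · have hxK : x ∈ K₁ := by
        by_contra h
        exact hxB (Or.inl ⟨hxS, h⟩)
      have hx' : grad D m (glue ⟨φ, hφ⟩ u v) x = grad D m v x := by
        rw [hx]
        simp [hφ1 x hxK]
      rw [hx']
      exact ⟨by rw [hux, hvx]; exact le_of_lt hxS, le_rfl⟩
    · have hxK : x ∈ K₂ := by
        by_contra h
        exact hxB (Or.inr ⟨hxS, h⟩)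
      have hx' : grad D m (glue ⟨φ, hφ⟩ u v) x = grad D m u x := by
        rw [hx]
        simp [hφ0 x (fun h => h hxK)]
      rw [hx']
      exact ⟨le_rfl, by rw [hux, hvx]; exact not_lt.1 hxS⟩

/-- Finitely many applications of `exists_glue_le_min`. -/
theorem exists_le_of_finitely_many (h𝒜 : UrysohnProperty 𝒜) (hD : IsGradientOperator μ D)
    (hL : IsCaratheodory μ L) {w : Fin m → 𝒜} (v : ℕ → Fin m → 𝒜)
    (hv : ∀ n, v n ∈ agreeOnSupport μ w) (k : ℕ) {M : ℝ}
    (hM : ∀ n ≤ k, ∀ᵐ x ∂μ, ‖grad D m (v n) x‖ ≤ M) {δ : ℝ≥0∞} (hδ : δ ≠ 0) :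
    ∃ z ∈ agreeOnSupport μ w, (∀ᵐ x ∂μ, ‖grad D m z x‖ ≤ M) ∧ ∃ B : Set X, MeasurableSet B ∧
      μ B ≤ δ ∧ ∀ᵐ x ∂μ, x ∉ B → ∀ n ≤ k, L x (grad D m z x) ≤ L x (grad D m (v n) x) := by
  induction k generalizing δ with
  | zero =>
    refine ⟨v 0, hv 0, hM 0 le_rfl, ∅, MeasurableSet.empty, by simp, ae_of_all _ ?_⟩
    intro x _ n hn
    rw [Nat.le_zero.1 hn]
  | succ k ih =>
    have hδ2 : δ / 2 ≠ 0 := by simpa using hδ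
    obtain ⟨z, hz, hzM, B, hB, hμB, hle⟩ := ih (fun n hn => hM n (hn.trans k.le_succ)) hδ2
    obtain ⟨z', hz', hzM', B', hB', hμB', hle'⟩ :=
      exists_glue_le_min h𝒜 hD hL hz (hv (k + 1)) hzM (hM _ le_rfl) hδ2
    refine ⟨z', hz', hzM', B ∪ B', hB.union hB', ?_, ?_⟩
    · calc μ (B ∪ B') ≤ μ B + μ B' := measure_union_le _ _
        _ ≤ δ / 2 + δ / 2 := add_le_add hμB hμB'
        _ = δ := ENNReal.add_halves δ
    · filter_upwards [hle, hle'] with x hx hx' hxB n hn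
      rw [Set.mem_union, not_or] at hxB
      obtain ⟨h1, h2⟩ := hx' hxB.2
      rcases Nat.le_succ_iff.1 hn with hn | rfl
      · exact h1.trans (hx hxB.1 n hn)
      · exact h2

/-- The finite infima decrease to the infimum over the sequence, and their integrals converge because
bounded gradients have finite energy. A finite infimum is attained off a set so small that the growth
condition makes the energy on it negligible. -/
theorem exists_energy_le_lintegral_iInf_add (h𝒜 : UrysohnProperty 𝒜)
    (hD : IsGradientOperator μ D) (hL : IsCaratheodory μ L) {p : ℝ≥0∞}
    (hgrowth : HasPolynomialGrowth μ p L) {w : Fin m → 𝒜} (v : ℕ → Fin m → 𝒜)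
    (hv : ∀ n, v n ∈ agreeOnSupport μ w) (A : Set X) {ε : ℝ≥0∞} (hε : ε ≠ 0) :
    ∃ z ∈ agreeOnSupport μ w,
      energy D L z A ≤ ∫⁻ x in A, ⨅ n, L x (grad D m (v n) x) ∂μ + ε := by
  obtain ⟨c, hc, hLc⟩ := hgrowth
  have hmeas : ∀ n, AEMeasurable (fun x => L x (grad D m (v n) x)) (μ.restrict A) := fun n =>
    (hL.aemeasurable_comp (Lp.aestronglyMeasurable (grad D m (v n)))).restrict
  -- the densities are bounded wherever the gradients are
  have hbound : ∀ (z : Fin m → 𝒜) (M : ℝ), (∀ᵐ x ∂μ, ‖grad D m z x‖ ≤ M) →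
      ∀ᵐ x ∂μ, L x (grad D m z x) ≤ ENNReal.ofReal (c * (1 + M ^ p.toReal)) := by
    intro z M hz
    filter_upwards [hz, hLc] with x hx hLx
    refine (hLx _).trans (ENNReal.ofReal_le_ofReal ?_)
    gcongr
  set F : ℕ → X → ℝ≥0∞ := fun k x => ⨅ n ≤ k, L x (grad D m (v n) x) with hF
  have hFle : ∀ k n, n ≤ k → ∀ x, F k x ≤ L x (grad D m (v n) x) := fun k n hn x =>
    iInf₂_le (f := fun n (_ : n ≤ k) => L x (grad D m (v n) x)) n hn
  have hFmeas : ∀ k, AEMeasurable (F k) (μ.restrict A) := fun k =>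
    AEMeasurable.iInf fun n => AEMeasurable.iInf fun _ => hmeas n
  have hFanti : ∀ x, Antitone fun k => F k x := fun x k l hkl =>
    biInf_mono fun n hn => le_trans hn hkl
  have hFfin : ∫⁻ x in A, F 0 x ∂μ ≠ ∞ := by
    have h : ∫⁻ x in A, F 0 x ∂μ ≤
        ∫⁻ _ in A, ENNReal.ofReal (c * (1 + ‖grad D m (v 0)‖ ^ p.toReal)) ∂μ := by
      refine lintegral_mono_ae (ae_restrict_of_ae ?_)
      filter_upwards [hbound _ _ (ae_norm_grad_le D (v 0))] with x hx
      exact (hFle 0 0 le_rfl x).trans hx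
    refine ne_top_of_le_ne_top ?_ h
    rw [lintegral_const]
    exact ENNReal.mul_ne_top ENNReal.ofReal_ne_top (measure_ne_top _ _)
  have hFinf : ∀ x, ⨅ k, F k x = ⨅ n, L x (grad D m (v n) x) := fun x =>
    le_antisymm (le_iInf fun n => (iInf_le _ n).trans (hFle n n le_rfl x))
      (le_iInf fun k => le_iInf₂ fun n _ => iInf_le _ n)
  have hint := lintegral_iInf' hFmeas (ae_of_all _ hFanti) hFfin
  simp_rw [hFinf] at hint
  have hε2 : ε / 2 ≠ 0 := by simpa using hε
  have hfin : ⨅ k, ∫⁻ x in A, F k x ∂μ ≠ ∞ := ne_top_of_le_ne_top hFfin (iInf_le _ 0)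
  obtain ⟨k, hk⟩ := iInf_lt_iff.1 (ENNReal.lt_add_right hfin hε2)
  set M : ℝ := ∑ n ∈ Finset.range (k + 1), ‖grad D m (v n)‖ with hM
  have hvM : ∀ n ≤ k, ∀ᵐ x ∂μ, ‖grad D m (v n) x‖ ≤ M := by
    intro n hn
    filter_upwards [ae_norm_grad_le D (v n)] with x hx
    exact hx.trans (Finset.single_le_sum (f := fun n => ‖grad D m (v n)‖)
      (fun _ _ => norm_nonneg _) (Finset.mem_range.2 (Nat.lt_succ_of_le hn)))
  set C : ℝ≥0∞ := ENNReal.ofReal (c * (1 + M ^ p.toReal)) with hC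
  obtain ⟨δ, hδ, hCδ⟩ : ∃ δ : ℝ≥0∞, δ ≠ 0 ∧ C * δ ≤ ε / 2 :=
    ⟨ε / 2 / C, (ENNReal.div_pos hε2 ENNReal.ofReal_ne_top).ne', ENNReal.mul_div_le⟩
  obtain ⟨z, hz, hzM, B, hB, hμB, hle⟩ := exists_le_of_finitely_many h𝒜 hD hL v hv k hvM hδ
  refine ⟨z, hz, ?_⟩
  calc energy D L z A ≤ ∫⁻ x in A, (F k x + B.indicator (fun _ => C) x) ∂μ := by
        refine lintegral_mono_ae (ae_restrict_of_ae ?_)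
        filter_upwards [hle, hbound z M hzM] with x hx hxC
        by_cases hxB : x ∈ B
        · rw [Set.indicator_of_mem hxB]
          exact hxC.trans le_add_self
        · rw [Set.indicator_of_notMem hxB, add_zero]
          exact le_iInf₂ (hx hxB)
    _ = ∫⁻ x in A, F k x ∂μ + C * μ.restrict A B := by
        rw [lintegral_add_right _ (measurable_const.indicator hB), lintegral_indicator_const hB]
    _ ≤ (⨅ k, ∫⁻ x in A, F k x ∂μ) + ε / 2 + ε / 2 := by
        gcongr
        refine le_trans ?_ hCδ
        gcongr
        exact (Measure.restrict_apply_le _ _).trans hμB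
    _ = ∫⁻ x in A, ⨅ n, L x (grad D m (v n) x) ∂μ + ε := by
        rw [hint, add_assoc, ENNReal.add_halves]

theorem hatEnergy_le_energy (u : Fin m → 𝒜) (A : Set X) :
    hatEnergy D L u A ≤ energy D L u A := by
  refine lintegral_mono fun x => ?_
  refine iInf_le_of_le ⟨(normalSpace D m x).starProjection (grad D m u x),
    Submodule.starProjection_apply_mem _ _⟩ (le_of_eq ?_)
  congr 1
  simp only [muGradFun, tangentSpace, Submodule.starProjection_orthogonal_val]
  abel

/-- Modifying `u` off the support of `μ` changes `∇u` by arbitrary normal fields, which is enough to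
bring the energy down to `Ê(u; A)`. -/
theorem exists_energy_le_hatEnergy_add (h𝒜 : UrysohnProperty 𝒜)
    (hD : IsGradientOperator μ D) (hL : IsCaratheodory μ L) {p : ℝ≥0∞}
    (hgrowth : HasPolynomialGrowth μ p L) (u : Fin m → 𝒜) (A : Set X) {ε : ℝ≥0∞} (hε : ε ≠ 0) :
    ∃ v ∈ agreeOnSupport μ u, energy D L v A ≤ hatEnergy D L u A + ε := by
  have hw : ∀ n, normalSeq D m n ∈ normalFields D m := (exists_normalSeq D m).choose_spec.1
  choose v₀ hv₀ hgrad using hw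
  have hv : ∀ n, u + v₀ n ∈ agreeOnSupport μ u := by
    intro n x hx i
    have h := hv₀ n x hx i
    simp at h
    simp [h]
  obtain ⟨z, hz, hle⟩ :=
    exists_energy_le_lintegral_iInf_add h𝒜 hD hL hgrowth (fun n => u + v₀ n) hv A hε
  refine ⟨z, hz, hle.trans ?_⟩
  gcongr
  refine lintegral_mono_ae (ae_restrict_of_ae ?_)
  have hadd : ∀ᵐ x ∂μ, ∀ n,
      grad D m (u + v₀ n) x = grad D m u x + normalSeq D m n x := by
    rw [ae_all_iff]
    intro n
    rw [← hgrad n, map_add]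
    exact Lp.coeFn_add _ _
  have hdense := normalSpace_minimal D m
    (fun x => closure (Set.range fun n => normalSeq D m n x))
    (ae_of_all _ fun _ => isClosed_closure) (exists_normalSeq D m).choose_spec.2
  filter_upwards [hadd, hdense, hL.continuous] with x hx hd hc
  simp_rw [hx]
  refine le_iInf fun ζ => ?_
  -- the normal component of the gradient is absorbed into the minimisation over the normal space
  set η : Mat m N := ζ - (normalSpace D m x).starProjection (grad D m u x) with hη
  have hηmem : η ∈ normalSpace D m x :=
    Submodule.sub_mem _ ζ.2 (Submodule.starProjection_apply_mem _ _)
  have heq : muGradFun D u x + (ζ : Mat m N) = grad D m u x + η := by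
    simp only [muGradFun, tangentSpace, Submodule.starProjection_orthogonal_val, hη]
    abel
  change _ ≤ L x (muGradFun D u x + (ζ : Mat m N))
  rw [heq]
  have hclosed : IsClosed {ξ : Mat m N |
      ⨅ n, L x (grad D m u x + normalSeq D m n x) ≤ L x (grad D m u x + ξ)} :=
    isClosed_le continuous_const (hc.comp (continuous_const.add continuous_id))
  refine closure_minimal ?_ hclosed (hd hηmem)
  rintro _ ⟨n, rfl⟩
  exact iInf_le (fun n => L x (grad D m u x + normalSeq D m n x)) n

end Relaxation

end MetricRelax

theorem proposition2p1
    {X : Type*} [MetricSpace X] [CompactSpace X] [MeasurableSpace X] [BorelSpace X]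
    (μ : MeasureTheory.Measure X) [MeasureTheory.IsFiniteMeasure μ]
    (𝒜 : Subalgebra ℝ C(X, ℝ)) (h𝒜 : MetricRelax.UrysohnProperty 𝒜)
    {m N : ℕ} (hm : 1 ≤ m) (hN : 1 ≤ N)
    (D : 𝒜 →ₗ[ℝ] MeasureTheory.Lp (MetricRelax.Vec N) ∞ μ)
    (hD : MetricRelax.IsGradientOperator μ D)
    (p : ℝ≥0∞) [Fact (1 ≤ p)] (hp : 1 < p) (hp' : p ≠ ∞)
    (L : X → MetricRelax.Mat m N → ℝ≥0∞)
    (hL : MetricRelax.IsCaratheodory μ L)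
    (hgrowth : MetricRelax.HasPolynomialGrowth μ p L)
    (u : MetricRelax.sobolevSpace D m p) (A : Set X) (hA : IsOpen A) :
    MetricRelax.relaxation (fun v => MetricRelax.energy D L v A) u.1.fst =
      MetricRelax.relaxation (fun v => MetricRelax.hatEnergy D L v A) u.1.fst := by
  open MetricRelax in
  refine le_antisymm (le_iInf₂ fun v hv => ?_) (le_iInf₂ fun v hv => ?_)
  · refine ENNReal.le_of_forall_pos_le_add fun ε hε _ => ?_
    have hε' : (ε : ℝ≥0∞) ≠ 0 := by exact_mod_cast hε.ne'
    choose z hz hzE using fun n => exists_energy_le_hatEnergy_add h𝒜 hD hL hgrowth (v n) A hε'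
    have hzu : Tendsto (fun n => toLpClass μ m p (z n)) atTop (𝓝 u.1.fst) :=
      hv.congr fun n => (toLpClass_eq_of_agreeOnSupport (hz n)).symm
    calc _ ≤ liminf (fun n => energy D L (z n) A) atTop := iInf₂_le z hzu
      _ ≤ liminf (fun n => hatEnergy D L (v n) A + ε) atTop :=
        liminf_le_liminf (Eventually.of_forall hzE)
      _ = _ := liminf_add_const atTop _ _ (by isBoundedDefault) (by isBoundedDefault)
  · exact (iInf₂_le v hv).trans
      (liminf_le_liminf (Eventually.of_forall fun n => hatEnergy_le_energy (v n) A))
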